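/- Consider an infinite-horizon Markov decision process with a measurable state space $\mathcal S$ (points measurable), a finite action set $\mathcal A$, a transition kernel giving the joint law of the random reward $\tilde r(s,a)$ and the next state $\tilde s'$, and a discount factor $\gamma\in(0,1]$. Policies $\pi$ are deterministic and history-dependent: the action at time $t$ is a measurable function of $(s_0,r_0,s_1,\dots,r_{t-1},s_t)$. Assume that under every policy and from every initial state the discounted return $\tilde g=\sum_{t\ge 0}\gamma^t\tilde r_t$ converges absolutely almost surely. For a real random variable $\tilde x$ put $\mathrm{VaR}_\alpha[\tilde x]=\sup\{x\in\mathbb R: P[\tilde x<x]\le\alpha\}\in[-\infty,\infty]$, $\alpha\in[0,1]$. For a policy $\pi$ let $q^\pi(s,\alpha,a)$ be the $\mathrm{VaR}_\alpha$ of the return when starting in $s$, taking action $a$ first and following $\pi$ afterwards; let $q^*(s,\alpha,a)=\sup_\pi q^\pi(s,\alpha,a)$, and let $v^*(s,\alpha)$ be the supremum over all policies $\pi$ of the $\mathrm{VaR}_\alpha$ of the return of $\pi$ from $s$. Given a function $q(s,\alpha,a)$, an initial state $s_0$ and a level $\alpha_0\in[0,1]$, the reward-tracking execution procedure does the following at each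 time $t=0,1,2,\dots$: it takes an action $a_t\in\arg\max_b q(s_t,\alpha_t,b)$, sets $z=q(s_t,\alpha_t,a_t)$, observes $r_t$ and $s_{t+1}$, and sets $\alpha_{t+1}=\min\{\beta\in[0,1]: \max_b q(s_{t+1},\beta,b)\ge (z-r_t)/\gamma\}$. Fix $s_0$ and $\alpha_0\in[0,1]$. Let $\bar\pi^*:\mathcal S\to\mathcal A$ be a (measurable) stationary Markovian policy that is $\alpha_0$-VaR optimal from $s_0$, i.e. it maximizes the $\mathrm{VaR}_{\alpha_0}$ of the return from $s_0$ over all history-dependent policies, and assume that it is the unique $\alpha_0$-VaR optimal policy: every $\alpha_0$-VaR optimal history-dependent policy takes the same actions as $\bar\pi^*$ at all times, almost surely along the trajectory of $\bar\pi^*$ from $s_0$. Then: 1. Running the procedure with $q=q^{\bar\pi^*}$ from $(s_0,\alpha_0)$ executes $\bar\pi^*$: any policy that selects its actions by the procedure (with whatever tie-breaking) almost surely takes the action $\bar\pi^*(s_t)$ at every time $t$, and its trajectory from $s_0$ has the same law as that of $\bar\pi^*$. 2. Almost surely along the trajectory of $\bar\pi^*$ from $s_0$ the procedure with $q^{\bar\pi^*}$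 is well defined (all the minima exist), and $\bar\pi^*(s_t)$ is the only maximizer of $q^{\bar\pi^*}(s_t,\alpha_t,\cdot)$ at every time $t$. 3. If $\mathcal S$ is countable, then almost surely $q^{\bar\pi^*}(s_t,\alpha_t,\bar\pi^*(s_t))=v^*(s_t,\alpha_t)$ at all pairs $(s_t,\alpha_t)$ visited by the procedure. 4. If $\mathcal S$ is countable and the supremum defining $v^*(s,\alpha)$ is attained for all $(s,\alpha)\in\mathcal S\times[0,1]$, then almost surely the same actions $\bar\pi^*(s_t)$ and the same levels $\alpha_t$ are also a run of the procedure with $q=q^*$. -/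

import Mathlib

open MeasureTheory ProbabilityTheory

noncomputable section

/-- Upper `α`-quantile `sup {x ∈ ℝ | P[X < x] ≤ α}` of a real random variable, as an extended real
(it is `⊤` at `α = 1`, and `⊥` at `α = 0` if `X` is essentially unbounded below). -/
def VaR {Ω : Type*} [MeasurableSpace Ω] (P : Measure Ω) (X : Ω → ℝ) (α : ℝ) : EReal :=
  sSup ((fun x : ℝ => (x : EReal)) '' {x : ℝ | P {ω | X ω < x} ≤ ENNReal.ofReal α})

/-- A Markov decision process with random rewards: `step (s, a)` is the joint law of the reward
`r̃(s, a)` and of the next state. -/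
structure MDP (S A : Type*) [MeasurableSpace S] [MeasurableSpace A] where
  step : Kernel (S × A) (ℝ × S)
  isMarkov : IsMarkovKernel step
  discount : ℝ
  discount_pos : 0 < discount
  discount_le_one : discount ≤ 1

/-- History-dependent deterministic policies. The `n`-th coordinate of a trajectory is
`(rₙ₋₁, sₙ)`, with the dummy `r₋₁ = 0`, so a history at time `n` is `(s₀, r₀, s₁, …, rₙ₋₁, sₙ)`;
past actions are functions of it. -/
structure HDPolicy (S A : Type*) [MeasurableSpace S] [MeasurableSpace A] where
  act : (n : ℕ) → (Finset.Iic n → ℝ × S) → A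
  measurable_act : ∀ n, Measurable (act n)

namespace HDPolicy

variable {S A : Type*} [MeasurableSpace S] [MeasurableSpace A]

/-- The stationary Markovian policy given by `f : S → A`. -/
def markov (f : S → A) (hf : Measurable f) : HDPolicy S A where
  act n h := f (h ⟨n, Finset.mem_Iic.2 le_rfl⟩).2
  measurable_act _ := hf.comp (measurable_snd.comp (measurable_pi_apply _))

/-- Take action `a` at time `0` and follow `π` afterwards. -/
def withFirst (a : A) (π : HDPolicy S A) : HDPolicy S A where
  act
    | 0 => fun _ => a
    | n + 1 => π.act (n + 1)
  measurable_act
    | 0 => measurable_const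
    | n + 1 => π.measurable_act (n + 1)

/-- The action taken by `π` at time `t` along the trajectory `ω`. -/
def action (π : HDPolicy S A) (ω : ℕ → ℝ × S) (t : ℕ) : A :=
  π.act t (fun i => ω i)

end HDPolicy

namespace MDP

variable {S A : Type*} [MeasurableSpace S] [MeasurableSpace A] (M : MDP S A)

/-- Law of `(rₙ, sₙ₊₁)` given the history at time `n`, under `π`. -/
def stepKernel (π : HDPolicy S A) (n : ℕ) : Kernel (Finset.Iic n → ℝ × S) (ℝ × S) :=
  M.step.comap (fun h => ((h ⟨n, Finset.mem_Iic.2 le_rfl⟩).2, π.act n h))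
    ((measurable_snd.comp (measurable_pi_apply _)).prodMk (π.measurable_act n))

instance (π : HDPolicy S A) (n : ℕ) : IsMarkovKernel (M.stepKernel π n) :=
  haveI := M.isMarkov
  inferInstanceAs (IsMarkovKernel (Kernel.comap _ _ _))

/-- Law of the infinite trajectory under `π` started in the state `s`. -/
def law (π : HDPolicy S A) (s : S) : Measure (ℕ → ℝ × S) :=
  Kernel.traj (X := fun _ => ℝ × S) (fun n => M.stepKernel π n) 0 (fun _ => (0, s))

/-- The reward `r_t` collected at time `t`. -/
def reward (ω : ℕ → ℝ × S) (t : ℕ) : ℝ := (ω (t + 1)).1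

/-- The discounted return `∑ γ^t r_t`. -/
def totalReturn (ω : ℕ → ℝ × S) : ℝ := ∑' t : ℕ, M.discount ^ t * reward ω t

/-- The return is well defined under every policy and from every initial state. -/
def ReturnWellDefined : Prop :=
  ∀ (π : HDPolicy S A) (s : S), ∀ᵐ ω ∂(M.law π s),
    Summable (fun t : ℕ => M.discount ^ t * reward ω t)

/-- `VaR^π_α[∑ γ^t r_t | s₀ = s]`. -/
def vPolicy (π : HDPolicy S A) (s : S) (α : ℝ) : EReal :=
  VaR (M.law π s) M.totalReturn α

/-- `VaR^π_α[∑ γ^t r_t | s₀ = s, a₀ = a]`. -/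
def qPolicy (π : HDPolicy S A) (s : S) (α : ℝ) (a : A) : EReal :=
  M.vPolicy (π.withFirst a) s α

/-- Optimal state quantile value. -/
def vStar (s : S) (α : ℝ) : EReal := ⨆ π : HDPolicy S A, M.vPolicy π s α

/-- Optimal state-action quantile value. -/
def qStar (s : S) (α : ℝ) (a : A) : EReal := ⨆ π : HDPolicy S A, M.qPolicy π s α a

/-- `π` maximizes the `α`-VaR of the return from `s` over all history-dependent policies. -/
def IsVaROptimal (s : S) (α : ℝ) (π : HDPolicy S A) : Prop :=
  ∀ π' : HDPolicy S A, M.vPolicy π' s α ≤ M.vPolicy π s α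

/-- The maximum defining `vStar` is attained at every state and every level. -/
def VStarAttained : Prop :=
  ∀ (s : S) (α : ℝ), α ∈ Set.Icc (0 : ℝ) 1 →
    ∃ π : HDPolicy S A, M.vPolicy π s α = M.vStar s α

/-- Along the trajectory `ω`, the actions `a` and levels `α` are produced by the reward-tracking
execution procedure with input `q`, `s₀`, `α₀`:
`a_t ∈ argmax_b q(s_t, α_t, b)`, `z = q(s_t, α_t, a_t)` and
`α_{t+1} = min {β ∈ [0, 1] | max_b q(s_{t+1}, β, b) ≥ (z - r_t) / γ}`. -/
structure IsRun (q : S → ℝ → A → EReal) (s₀ : S) (α₀ : ℝ)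
    (ω : ℕ → ℝ × S) (a : ℕ → A) (α : ℕ → ℝ) : Prop where
  state_zero : (ω 0).2 = s₀
  level_zero : α 0 = α₀
  argmax : ∀ t b, q (ω t).2 (α t) b ≤ q (ω t).2 (α t) (a t)
  level_succ : ∀ t, IsLeast
    {β : ℝ | β ∈ Set.Icc (0 : ℝ) 1 ∧
      (q (ω t).2 (α t) (a t) - ((reward ω t : ℝ) : EReal)) / ((M.discount : ℝ) : EReal)
        ≤ ⨆ b : A, q (ω (t + 1)).2 β b}
    (α (t + 1))

end MDP

end

/-! Write `F` for `markov f`, `v` for its quantile value, and `G_t` for the discounted return from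
time `t` on. Quantiles and distribution functions form a Galois connection: `z ≤ VaR_α` iff `P[X <
z] ≤ α`. Hence the smallest level at which `F` reaches a target `y` from `s` is the probability that
its return from `s` is below `y`. This gives explicit candidates for the run: targets `y_{t+1} =
(v(s_t, α_t) - r_t) / γ` and levels `α_{t+1} = P^F_{s_{t+1}}[G < y_{t+1}]` (`target`, `level`).

Two facts drive the proof. Along every summable trajectory, `G_0 < v(s_0, α_0)` forces `G_t < y_t`
for all `t` (`totalReturn_shift_lt_target`). Under `F`, the levels satisfy `E[α_t] ≤ α_0`
(`lintegral_level_le`). So if `F` is replaced from time `t` on by a policy `π` wherever `P^π_{s_t}[G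
< y_t] ≤ α_t`, the new policy satisfies `P[G_0 < v(s_0, α_0)] ≤ P[G_t < y_t] ≤ E[α_t] ≤ α_0` and is
still optimal (`IsVaROptimal.switch`). By uniqueness such a `π` almost surely acts as `f`
(`ae_action_eq_of_returnBelow_target_le`).

Taking for `π` a deviation in the first action only, every action other than `f(s_t)` strictly
misses the target (`ae_isStrictAt`). This makes the maximizer unique and the candidate levels the
required minima. For optimality among all policies, a policy that beats `F` at `(s_t, α_t)`, or
reaches `y_{t+1}` at a level below `α_{t+1}`, would have the same law as `F`, a contradiction. The
exceptional null set depends on `π`, so these arguments run over countable families of policies,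
with rational values or levels. -/

noncomputable section

/-! ### Finite histories and measures on sequences -/

section Trajectories

open Preorder

variable {X : Type*}

/-- Extend a finite history to an infinite sequence, constant from time `n` on. -/
def extendHistory (n : ℕ) (h : Finset.Iic n → X) : ℕ → X :=
  fun i => h ⟨min i n, Finset.mem_Iic.2 (min_le_right i n)⟩

lemma extendHistory_apply_of_le {n i : ℕ} (h : Finset.Iic n → X) (hi : i ≤ n) :
    extendHistory n h i = h ⟨i, Finset.mem_Iic.2 hi⟩ := by
  simp [extendHistory, min_eq_left hi]

lemma extendHistory_frestrictLe_of_le {n i : ℕ} (ω : ℕ → X) (hi : i ≤ n) :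
    extendHistory n (frestrictLe (π := fun _ => X) n ω) i = ω i := by
  rw [extendHistory_apply_of_le _ hi]; rfl

variable [MeasurableSpace X]

@[fun_prop]
lemma measurable_extendHistory (n : ℕ) : Measurable (extendHistory (X := X) n) :=
  measurable_pi_lambda _ fun _ => measurable_pi_apply _

lemma map_frestrictLe_succ_eq {ν ν' : Measure (ℕ → X)} {n : ℕ}
    (h : ν.map (fun ω => (frestrictLe (π := fun _ => X) n ω, ω (n + 1))) =
      ν'.map (fun ω => (frestrictLe (π := fun _ => X) n ω, ω (n + 1)))) :
    ν.map (frestrictLe (π := fun _ => X) (n + 1)) =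
      ν'.map (frestrictLe (π := fun _ => X) (n + 1)) := by
  let glue : (Finset.Iic n → X) × X → (Finset.Iic (n + 1) → X) :=
    fun p i => if (i : ℕ) ≤ n then extendHistory n p.1 i else p.2
  have hglue : Measurable glue := by
    refine measurable_pi_lambda _ fun i => ?_
    by_cases hi : (i : ℕ) ≤ n
    · simp only [glue, hi, if_true]
      exact (measurable_pi_apply (i : ℕ)).fun_comp ((measurable_extendHistory n).comp measurable_fst)
    · simp only [glue, hi, if_false]
      exact measurable_snd
  have hm : Measurable (fun ω : ℕ → X => (frestrictLe (π := fun _ => X) n ω, ω (n + 1))) := by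
    fun_prop
  have hcomp : frestrictLe (π := fun _ => X) (n + 1) =
      glue ∘ fun ω => (frestrictLe (π := fun _ => X) n ω, ω (n + 1)) := by
    ext ω i
    obtain ⟨i, hi⟩ := i
    by_cases hin : i ≤ n
    · simp only [glue, Function.comp, hin, if_true]
      rw [extendHistory_frestrictLe_of_le ω hin]; rfl
    · have : i = n + 1 := by have := Finset.mem_Iic.1 hi; omega
      subst this
      simp [glue]
  rw [hcomp, ← Measure.map_map hglue hm, ← Measure.map_map hglue hm, h]

/-- Every finite set of times lies in an initial segment, so the initial marginals determine all
finite-dimensional ones, and a projective limit is unique. -/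
lemma Measure.ext_of_map_frestrictLe {ν ν' : Measure (ℕ → X)} [IsFiniteMeasure ν]
    (h : ∀ n, ν.map (frestrictLe (π := fun _ => X) n) =
      ν'.map (frestrictLe (π := fun _ => X) n)) : ν = ν' := by
  have hν : IsProjectiveLimit (α := fun _ : ℕ => X) ν fun I => ν.map I.restrict := fun I => rfl
  refine hν.unique fun I => ?_
  have hI : (I.restrict : (ℕ → X) → _) =
      Finset.restrict₂ (π := fun _ => X) I.subset_Iic_sup_id ∘
        frestrictLe (π := fun _ => X) (I.sup id) := rfl
  have hm : Measurable (Finset.restrict₂ (π := fun _ => X) I.subset_Iic_sup_id) :=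
    Finset.measurable_restrict₂ _
  simp only [hI]
  rw [← Measure.map_map hm (by fun_prop), ← Measure.map_map hm (by fun_prop), h]

lemma compProd_comap_map {Y Z : Type*} [MeasurableSpace Y] [MeasurableSpace Z]
    (μ : Measure X) [SFinite μ] (κ : Kernel Y Z) [IsSFiniteKernel κ] {g : X → Y}
    (hg : Measurable g) :
    (μ ⊗ₘ κ.comap g hg).map (Prod.map g id) = (μ.map g) ⊗ₘ κ := by
  ext s hs
  rw [Measure.map_apply (by fun_prop) hs, Measure.compProd_apply hs,
    Measure.compProd_apply ((hg.prodMap measurable_id) hs),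
    lintegral_map (Kernel.measurable_kernel_prodMk_left hs) hg]
  rfl

end Trajectories

/-! ### Trajectory laws and the Markov property -/

namespace MDP

section Shift

variable {S : Type*}

/-- The trajectory seen from time `t` on, with the dummy reward reset. -/
def shift (t : ℕ) (ω : ℕ → ℝ × S) : ℕ → ℝ × S
  | 0 => (0, (ω t).2)
  | n + 1 => ω (t + (n + 1))

@[simp] lemma shift_zero_apply (t : ℕ) (ω : ℕ → ℝ × S) : shift t ω 0 = (0, (ω t).2) := rfl

@[simp] lemma shift_succ_apply (t n : ℕ) (ω : ℕ → ℝ × S) :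
    shift t ω (n + 1) = ω (t + (n + 1)) := rfl

lemma shift_apply_snd (t n : ℕ) (ω : ℕ → ℝ × S) : (shift t ω n).2 = (ω (t + n)).2 := by
  cases n <;> rfl

lemma shift_congr {t n : ℕ} {ω ω' : ℕ → ℝ × S} (h : ∀ i ≤ t + n, ω i = ω' i) :
    ∀ i ≤ n, shift t ω i = shift t ω' i := by
  intro i hi
  cases i with
  | zero => simp [h t (by omega)]
  | succ i => simp [h (t + (i + 1)) (by omega)]

end Shift

open Preorder

variable {S A : Type*} [MeasurableSpace S] [MeasurableSpace A] (M : MDP S A)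

@[fun_prop]
lemma measurable_shift (t : ℕ) : Measurable (shift (S := S) t) := by
  refine measurable_pi_lambda _ fun n => ?_
  cases n with
  | zero => exact measurable_const.prodMk (measurable_snd.comp (measurable_pi_apply t))
  | succ n => exact measurable_pi_apply _

lemma action_congr (π : HDPolicy S A) {n : ℕ} {ω ω' : ℕ → ℝ × S}
    (h : ∀ i ≤ n, ω i = ω' i) : π.action ω n = π.action ω' n := by
  unfold HDPolicy.action
  congr 1
  funext i
  exact h i (Finset.mem_Iic.1 i.2)

lemma measurable_action (π : HDPolicy S A) (n : ℕ) : Measurable fun ω => π.action ω n :=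
  (π.measurable_act n).comp (measurable_pi_lambda _ fun _ => measurable_pi_apply _)

instance (π : HDPolicy S A) (s : S) : IsProbabilityMeasure (M.law π s) := by
  unfold law; infer_instance

/-- The conditional law of the trajectory given the history at time `t`. -/
def condLaw (π : HDPolicy S A) (t : ℕ) : Kernel (Finset.Iic t → ℝ × S) (ℕ → ℝ × S) :=
  Kernel.traj (X := fun _ => ℝ × S) (fun n => M.stepKernel π n) t

instance (π : HDPolicy S A) (t : ℕ) : IsMarkovKernel (M.condLaw π t) := by
  unfold condLaw; infer_instance

lemma condLaw_ae_eq [MeasurableSingletonClass S] (π : HDPolicy S A) (ω₀ : ℕ → ℝ × S) (t : ℕ) :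
    ∀ᵐ ω ∂M.condLaw π t (frestrictLe (π := fun _ => ℝ × S) t ω₀),
      frestrictLe (π := fun _ => ℝ × S) t ω = frestrictLe (π := fun _ => ℝ × S) t ω₀ := by
  refine ae_of_ae_map (f := frestrictLe (π := fun _ => ℝ × S) t)
    (p := fun h => h = frestrictLe (π := fun _ => ℝ × S) t ω₀)
    (measurable_frestrictLe t).aemeasurable ?_
  rw [condLaw, Kernel.traj_map_frestrictLe_apply, Kernel.partialTraj_self, Kernel.id_apply,
    ae_dirac_eq]
  simp

lemma condLaw_map_step (π : HDPolicy S A) {t n : ℕ} (htn : t ≤ n)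
    (h : Finset.Iic t → ℝ × S) :
    (M.condLaw π t h).map (fun ω => (frestrictLe (π := fun _ => ℝ × S) n ω, ω (n + 1))) =
      ((M.condLaw π t h).map (frestrictLe (π := fun _ => ℝ × S) n)) ⊗ₘ M.stepKernel π n := by
  have := Kernel.partialTraj_compProd_eq_map_traj (X := fun _ => ℝ × S)
    (κ := fun n => M.stepKernel π n) htn (x₀ := h)
  rw [condLaw, ← this, Kernel.traj_map_frestrictLe_apply]

lemma law_eq_condLaw (π : HDPolicy S A) (s : S) :
    M.law π s = M.condLaw π 0 (fun _ => (0, s)) := rfl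

lemma law_map_step (π : HDPolicy S A) (s : S) (n : ℕ) :
    (M.law π s).map (fun ω => (frestrictLe (π := fun _ => ℝ × S) n ω, ω (n + 1))) =
      ((M.law π s).map (frestrictLe (π := fun _ => ℝ × S) n)) ⊗ₘ M.stepKernel π n :=
  M.condLaw_map_step π (Nat.zero_le n) _

lemma law_ae_zero [MeasurableSingletonClass S] (π : HDPolicy S A) (s : S) : ∀ᵐ ω ∂M.law π s, (ω 0) = (0, s) := by
  have := M.condLaw_ae_eq π (fun _ => (0, s)) 0
  filter_upwards [this] with ω hω
  exact congrFun hω ⟨0, by simp⟩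

lemma stepKernel_frestrictLe (π : HDPolicy S A) (n : ℕ) (ω : ℕ → ℝ × S) :
    M.stepKernel π n (frestrictLe (π := fun _ => ℝ × S) n ω) =
      M.step ((ω n).2, π.action ω n) := rfl

lemma map_frestrictLe_zero_of_ae {ν : Measure (ℕ → ℝ × S)} [IsProbabilityMeasure ν] {s : S}
    (h : ∀ᵐ ω ∂ν, ω 0 = (0, s)) :
    ν.map (frestrictLe (π := fun _ => ℝ × S) 0) = Measure.dirac (fun _ => (0, s)) := by
  have : frestrictLe (π := fun _ => ℝ × S) 0 =ᵐ[ν] fun _ _ => (0, s) := by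
    filter_upwards [h] with ω hω
    ext1 i
    obtain ⟨i, hi⟩ := i
    have : i = 0 := by simpa using hi
    subst this
    exact hω
  rw [Measure.map_congr this, Measure.map_const]
  simp

/-- A trajectory measure with the transition probabilities of `π` is the law of `π`. -/
lemma eq_law_of_map_step [MeasurableSingletonClass S] (π : HDPolicy S A) (s : S)
    {ν : Measure (ℕ → ℝ × S)} [IsProbabilityMeasure ν] (h0 : ∀ᵐ ω ∂ν, ω 0 = (0, s))
    (hstep : ∀ n, ν.map (fun ω => (frestrictLe (π := fun _ => ℝ × S) n ω, ω (n + 1))) =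
      (ν.map (frestrictLe (π := fun _ => ℝ × S) n)) ⊗ₘ M.stepKernel π n) :
    ν = M.law π s := by
  refine Measure.ext_of_map_frestrictLe fun n => ?_
  induction n with
  | zero =>
    rw [map_frestrictLe_zero_of_ae h0, map_frestrictLe_zero_of_ae (M.law_ae_zero π s)]
  | succ n ih =>
    refine map_frestrictLe_succ_eq ?_
    rw [hstep, law_map_step, ih]

lemma law_map_frestrictLe_zero [MeasurableSingletonClass S] (π π' : HDPolicy S A) (s : S) :
    (M.law π s).map (frestrictLe (π := fun _ => ℝ × S) 0) =
      (M.law π' s).map (frestrictLe (π := fun _ => ℝ × S) 0) := by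
  rw [map_frestrictLe_zero_of_ae (M.law_ae_zero π s),
    map_frestrictLe_zero_of_ae (M.law_ae_zero π' s)]

/-- Only agreement at time `n` is assumed, so that an induction may derive this agreement from
equality of the marginals up to `n`. -/
lemma law_map_frestrictLe_succ [DiscreteMeasurableSpace A] [Countable A]
    (π π' : HDPolicy S A) (s : S) {n : ℕ}
    (h : (M.law π s).map (frestrictLe (π := fun _ => ℝ × S) n) =
      (M.law π' s).map (frestrictLe (π := fun _ => ℝ × S) n))
    (hact : ∀ᵐ ω ∂M.law π s, π.action ω n = π'.action ω n) :
    (M.law π s).map (frestrictLe (π := fun _ => ℝ × S) (n + 1)) =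
      (M.law π' s).map (frestrictLe (π := fun _ => ℝ × S) (n + 1)) := by
  refine map_frestrictLe_succ_eq ?_
  rw [law_map_step, law_map_step, ← h]
  refine Measure.compProd_congr ?_
  have hms : MeasurableSet {h : Finset.Iic n → ℝ × S | π.act n h = π'.act n h} :=
    measurableSet_eq_fun (π.measurable_act n) (π'.measurable_act n)
  have : ∀ᵐ h ∂(M.law π s).map (frestrictLe (π := fun _ => ℝ × S) n),
      π.act n h = π'.act n h :=
    (ae_map_iff (measurable_frestrictLe n).aemeasurable hms).2 hact
  filter_upwards [this] with h hh
  simp only [stepKernel, Kernel.comap_apply, hh]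

/-- Policies that almost surely take the same actions have the same law. -/
lemma law_congr [MeasurableSingletonClass S] [DiscreteMeasurableSpace A] [Countable A]
    (π π' : HDPolicy S A) (s : S)
    (hact : ∀ᵐ ω ∂M.law π s, ∀ n, π.action ω n = π'.action ω n) :
    M.law π s = M.law π' s := by
  refine Measure.ext_of_map_frestrictLe fun n => ?_
  induction n with
  | zero => exact M.law_map_frestrictLe_zero π π' s
  | succ n ih => exact M.law_map_frestrictLe_succ π π' s ih (hact.mono fun ω h => h n)

lemma ae_law_iff_of_map_frestrictLe_eq {π π' : HDPolicy S A} {s : S} {n : ℕ}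
    (h : (M.law π s).map (frestrictLe (π := fun _ => ℝ × S) n) =
      (M.law π' s).map (frestrictLe (π := fun _ => ℝ × S) n))
    {p : (ℕ → ℝ × S) → Prop} (hp : MeasurableSet {ω | p ω}) (hdep : DependsOn p (Set.Iic n)) :
    (∀ᵐ ω ∂M.law π s, p ω) ↔ ∀ᵐ ω ∂M.law π' s, p ω := by
  have hm : MeasurableSet {h : Finset.Iic n → ℝ × S | p (extendHistory n h)} :=
    measurable_extendHistory n hp
  have key : ∀ ω, p ω ↔ p (extendHistory n (frestrictLe (π := fun _ => ℝ × S) n ω)) := by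
    intro ω
    exact iff_of_eq (hdep fun i hi => (extendHistory_frestrictLe_of_le ω hi).symm)
  rw [Filter.eventually_congr (Filter.Eventually.of_forall key),
    Filter.eventually_congr (Filter.Eventually.of_forall key)]
  have hf : Measurable (frestrictLe (π := fun _ => ℝ × S) n) := measurable_frestrictLe n
  have e (ρ : HDPolicy S A) :
      (∀ᵐ ω ∂M.law ρ s, p (extendHistory n (frestrictLe (π := fun _ => ℝ × S) n ω))) ↔
        ∀ᵐ h ∂(M.law ρ s).map (frestrictLe (π := fun _ => ℝ × S) n), p (extendHistory n h) :=
    (ae_map_iff hf.aemeasurable hm).symm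
  rw [e, e, h]

lemma lintegral_law_eq_of_map_frestrictLe_eq {π π' : HDPolicy S A} {s : S} {n : ℕ}
    (h : (M.law π s).map (frestrictLe (π := fun _ => ℝ × S) n) =
      (M.law π' s).map (frestrictLe (π := fun _ => ℝ × S) n))
    {g : (ℕ → ℝ × S) → ENNReal} (hg : Measurable g) (hdep : DependsOn g (Set.Iic n)) :
    ∫⁻ ω, g ω ∂M.law π s = ∫⁻ ω, g ω ∂M.law π' s := by
  have hm : Measurable fun h : Finset.Iic n → ℝ × S => g (extendHistory n h) :=
    hg.comp (measurable_extendHistory n)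
  have key : ∀ ω, g ω = g (extendHistory n (frestrictLe (π := fun _ => ℝ × S) n ω)) :=
    fun ω => hdep fun i hi => (extendHistory_frestrictLe_of_le ω hi).symm
  rw [lintegral_congr key, lintegral_congr key, ← lintegral_map hm (measurable_frestrictLe n), h, lintegral_map hm (measurable_frestrictLe n)]

/-- If `ρ` acts from time `t` on as `σ` does on the shifted trajectory, then the shifted trajectory
has the law of `σ`. -/
lemma condLaw_map_shift [MeasurableSingletonClass S] (ρ σ : HDPolicy S A) (t : ℕ)
    (ω₀ : ℕ → ℝ × S)
    (hact : ∀ ω n, (∀ i ≤ t, ω i = ω₀ i) → ρ.action ω (t + n) = σ.action (shift t ω) n) :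
    (M.condLaw ρ t (frestrictLe (π := fun _ => ℝ × S) t ω₀)).map (shift t) =
      M.law σ (ω₀ t).2 := by
  set ν := M.condLaw ρ t (frestrictLe (π := fun _ => ℝ × S) t ω₀) with hν
  have hagree : ∀ᵐ ω ∂ν, ∀ i ≤ t, ω i = ω₀ i := by
    filter_upwards [M.condLaw_ae_eq ρ ω₀ t] with ω hω i hi
    exact congrFun hω ⟨i, Finset.mem_Iic.2 hi⟩
  have : IsProbabilityMeasure (ν.map (shift t)) :=
    Measure.isProbabilityMeasure_map (measurable_shift t).aemeasurable
  refine M.eq_law_of_map_step σ _ ?_ fun n => ?_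
  · refine (ae_map_iff (measurable_shift t).aemeasurable
      (measurable_pi_apply 0 (measurableSet_singleton (0, (ω₀ t).2)))).2 ?_
    filter_upwards [hagree] with ω hω
    simp [hω t le_rfl]
  -- `g` reads the first `n + 1` coordinates of the shifted trajectory off the history at time `t +
  -- n`.
  let g : (Finset.Iic (t + n) → ℝ × S) → (Finset.Iic n → ℝ × S) :=
    fun h => frestrictLe (π := fun _ => ℝ × S) n (shift t (extendHistory (t + n) h))
  have hg : Measurable g := by fun_prop
  have hgr : ∀ ω, g (frestrictLe (π := fun _ => ℝ × S) (t + n) ω) =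
      frestrictLe (π := fun _ => ℝ × S) n (shift t ω) := by
    intro ω
    funext i
    exact shift_congr (fun i hi => extendHistory_frestrictLe_of_le ω hi) i
      (Finset.mem_Iic.1 i.2)
  have hstep := M.condLaw_map_step ρ (Nat.le_add_right t n)
    (frestrictLe (π := fun _ => ℝ × S) t ω₀)
  rw [← hν] at hstep
  -- The two kernels need only agree on histories that extend `ω₀` up to time `t`; these carry all
  -- the mass of `ν`.
  have hker : (fun h => M.stepKernel ρ (t + n) h)
      =ᵐ[ν.map (frestrictLe (π := fun _ => ℝ × S) (t + n))]
      fun h => (M.stepKernel σ n).comap g hg h := by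
    have hms : MeasurableSet {h : Finset.Iic (t + n) → ℝ × S |
        ∀ i ≤ t, extendHistory (t + n) h i = ω₀ i} := by
      simp only [Set.ofPred_forall]
      exact MeasurableSet.iInter fun i => MeasurableSet.iInter fun _ =>
        ((measurable_pi_apply i).fun_comp (measurable_extendHistory (t + n)))
          (measurableSet_singleton _)
    have hae : ∀ᵐ h ∂ν.map (frestrictLe (π := fun _ => ℝ × S) (t + n)),
        ∀ i ≤ t, extendHistory (t + n) h i = ω₀ i := by
      have hf : Measurable (frestrictLe (π := fun _ => ℝ × S) (t + n)) :=
        measurable_frestrictLe _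
      refine (ae_map_iff hf.aemeasurable hms).2 ?_
      filter_upwards [hagree] with ω hω i hi
      rw [extendHistory_frestrictLe_of_le ω (by omega), hω i hi]
    filter_upwards [hae] with h hh
    have hr : frestrictLe (π := fun _ => ℝ × S) (t + n) (extendHistory (t + n) h) = h := by
      funext i
      exact extendHistory_apply_of_le h (Finset.mem_Iic.1 i.2)
    have hσ := hact (extendHistory (t + n) h) n hh
    rw [Kernel.comap_apply, stepKernel_frestrictLe, shift_apply_snd, ← hσ,
      ← stepKernel_frestrictLe, hr]
  rw [Measure.compProd_congr hker] at hstep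
  rw [Measure.map_map (by fun_prop) (by fun_prop), Measure.map_map (by fun_prop) (by fun_prop)]
  have h1 : (fun ω : ℕ → ℝ × S => (frestrictLe (π := fun _ => ℝ × S) n ω, ω (n + 1))) ∘ shift t =
      Prod.map g id ∘ fun ω => (frestrictLe (π := fun _ => ℝ × S) (t + n) ω, ω (t + n + 1)) := by
    funext ω
    simp only [Function.comp, Prod.map, hgr, id]
    rfl
  have h2 : frestrictLe (π := fun _ => ℝ × S) n ∘ shift t =
      g ∘ frestrictLe (π := fun _ => ℝ × S) (t + n) := by
    funext ω
    simp only [Function.comp, hgr]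
  rw [h1, h2, ← Measure.map_map (by fun_prop) (by fun_prop), hstep,
    ← Measure.map_map hg (by fun_prop), compProd_comap_map]

/-- The Markov property: given the history at time `t`, the shifted trajectory has the law of the
policy followed from then on. -/
lemma law_markov_property [MeasurableSingletonClass S] (ρ : HDPolicy S A)
    (σ : (ℕ → ℝ × S) → HDPolicy S A) (t : ℕ) (s : S)
    (hact : ∀ ω₀ ω n, (∀ i ≤ t, ω i = ω₀ i) →
      ρ.action ω (t + n) = (σ ω₀).action (shift t ω) n)
    {B : Set ((ℕ → ℝ × S) × (ℕ → ℝ × S))} (hB : MeasurableSet B)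
    (hdep : ∀ ω', DependsOn (fun ω => (ω, ω') ∈ B) (Set.Iic t)) :
    M.law ρ s {ω | (ω, shift t ω) ∈ B} =
      ∫⁻ ω, M.law (σ ω) (ω t).2 {ω' | (ω, ω') ∈ B} ∂M.law ρ s := by
  let C : Set ((Finset.Iic t → ℝ × S) × (ℕ → ℝ × S)) :=
    {p | (extendHistory t p.1, shift t p.2) ∈ B}
  have hC : MeasurableSet C :=
    (((measurable_extendHistory t).comp measurable_fst).prodMk
      ((measurable_shift t).comp measurable_snd)) hB
  have hrestr : ∀ ω ω', (extendHistory t (frestrictLe (π := fun _ => ℝ × S) t ω), ω') ∈ B ↔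
      (ω, ω') ∈ B := fun ω ω' =>
    iff_of_eq (hdep ω' fun i hi => extendHistory_frestrictLe_of_le ω hi)
  have hset : {ω | (ω, shift t ω) ∈ B} =
      (fun ω => (frestrictLe (π := fun _ => ℝ × S) t ω, ω)) ⁻¹' C := by
    ext ω
    exact (hrestr ω (shift t ω)).symm
  -- Disintegration of the joint law of history and trajectory over the history at time `t`.
  have hprod := Kernel.partialTraj_compProd_traj (X := fun _ => ℝ × S)
    (κ := fun n => M.stepKernel ρ n) (Nat.zero_le t) (fun _ => (0, s))
  rw [← Kernel.traj_map_frestrictLe_apply] at hprod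
  change ((M.law ρ s).map _) ⊗ₘ (M.condLaw ρ t) = (M.law ρ s).map _ at hprod
  rw [hset, ← Measure.map_apply (by fun_prop) hC, ← hprod, Measure.compProd_apply hC,
    lintegral_map (Kernel.measurable_kernel_prodMk_left hC) (by fun_prop)]
  refine lintegral_congr fun ω => ?_
  rw [← M.condLaw_map_shift ρ (σ ω) t ω (hact ω)]
  change _ = (Measure.map (shift t) _) (Prod.mk ω ⁻¹' B)
  rw [Measure.map_apply (measurable_shift t) (measurable_prodMk_left hB)]
  congr 1
  ext ω'
  exact hrestr ω (shift t ω')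

end MDP

/-! ### Quantiles with extended real thresholds -/

section VaR

/-- Galois connection between quantiles and distribution functions, at extended real arguments. -/
lemma le_VaR_iff {Ω : Type*} [MeasurableSpace Ω] (P : Measure Ω) (X : Ω → ℝ) (α : ℝ)
    (z : EReal) : z ≤ VaR P X α ↔ P {ω | (X ω : EReal) < z} ≤ ENNReal.ofReal α := by
  constructor
  · intro hz
    have hlt : ∀ q : ℚ, ((q : ℝ) : EReal) < z → P {ω | X ω < q} ≤ ENNReal.ofReal α := by
      intro q hq
      obtain ⟨_, ⟨x, hx, rfl⟩, hqx⟩ := lt_sSup_iff.1 (hq.trans_le hz)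
      refine (measure_mono fun ω (hω : X ω < q) => ?_).trans hx
      exact hω.trans (EReal.coe_lt_coe_iff.1 hqx)
    -- Continuity from below along rational thresholds: the inequality in the event is strict, so
    -- the bound passes to the supremum.
    have hU : {ω | (X ω : EReal) < z} ⊆
        ⋃ q : {q : ℚ // ((q : ℝ) : EReal) < z}, {ω | X ω < (q : ℚ)} := by
      intro ω hω
      obtain ⟨q, hq1, hq2⟩ := EReal.lt_iff_exists_rat_btwn.1 (show (X ω : EReal) < z from hω)
      exact Set.mem_iUnion.2 ⟨⟨q, hq2⟩, EReal.coe_lt_coe_iff.1 hq1⟩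
    refine (measure_mono hU).trans ?_
    have hmono : Monotone fun q : {q : ℚ // ((q : ℝ) : EReal) < z} => {ω | X ω < (q : ℚ)} := by
      intro q q' hqq' ω (hω : X ω < (q : ℚ))
      exact hω.trans_le (by exact_mod_cast hqq')
    rw [hmono.measure_iUnion]
    exact iSup_le fun q => hlt q q.2
  · intro h
    refine EReal.ge_of_forall_gt_iff_ge.1 fun x hx => ?_
    refine le_sSup ⟨x, (measure_mono fun ω (hω : X ω < x) => ?_).trans h, rfl⟩
    exact (EReal.coe_lt_coe_iff.2 hω).trans hx

/-- Moves a threshold for the remaining return back by one step. The infinite values of `z` are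
needed because quantiles may be infinite. -/
lemma lt_sub_div_iff (g r γ : ℝ) (hγ : 0 < γ) (z : EReal) :
    (g : EReal) < (z - (r : EReal)) / (γ : EReal) ↔ ((r + γ * g : ℝ) : EReal) < z := by
  induction z with
  | bot => simp [EReal.bot_div_of_pos_ne_top (EReal.coe_pos.2 hγ) (EReal.coe_ne_top γ)]
  | top =>
    have := EReal.coe_lt_top (r + γ * g)
    simp_all [EReal.top_div_of_pos_ne_top (EReal.coe_pos.2 hγ) (EReal.coe_ne_top γ)]
  | coe z =>
    rw [← EReal.coe_sub, ← EReal.coe_div, EReal.coe_lt_coe_iff, EReal.coe_lt_coe_iff,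
      lt_div_iff₀ hγ]
    constructor <;> intro h <;> linarith

end VaR

section DependsOn

variable {X Y Z W : Type*}

lemma DependsOn.mono_Iic {g : (ℕ → X) → Y} {m n : ℕ} (hg : DependsOn g (Set.Iic m))
    (hmn : m ≤ n) : DependsOn g (Set.Iic n) :=
  fun _ _ h => hg fun i hi => h i (le_trans (Set.mem_Iic.1 hi) hmn)

lemma dependsOn_eval {n i : ℕ} (hi : i ≤ n) : DependsOn (fun ω : ℕ → X => ω i) (Set.Iic n) :=
  fun _ _ h => h i hi

lemma DependsOn.map {g : (ℕ → X) → Y} {n : ℕ} (hg : DependsOn g (Set.Iic n)) (φ : Y → Z) :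
    DependsOn (fun ω => φ (g ω)) (Set.Iic n) :=
  fun _ _ h => congrArg φ (hg h)

lemma DependsOn.map₂ {g : (ℕ → X) → Y} {g' : (ℕ → X) → Z} {n : ℕ}
    (hg : DependsOn g (Set.Iic n)) (hg' : DependsOn g' (Set.Iic n)) (φ : Y → Z → W) :
    DependsOn (fun ω => φ (g ω) (g' ω)) (Set.Iic n) :=
  fun _ _ h => congrArg₂ φ (hg h) (hg' h)

end DependsOn

/-! ### Levels and targets of the procedure -/

namespace MDP

open Preorder

variable {S A : Type*} [MeasurableSpace S] [MeasurableSpace A] (M : MDP S A)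

@[fun_prop]
lemma measurable_totalReturn : Measurable (M.totalReturn (S := S) (A := A)) := by
  unfold totalReturn reward
  fun_prop

/-- The probability under `π` from `s` that the return is below `y`. -/
def returnBelow (π : HDPolicy S A) (s : S) (y : EReal) : ENNReal :=
  M.law π s {ω | (M.totalReturn ω : EReal) < y}

lemma returnBelow_le_one (π : HDPolicy S A) (s : S) (y : EReal) : M.returnBelow π s y ≤ 1 :=
  prob_le_one

lemma returnBelow_mono (π : HDPolicy S A) (s : S) {y z : EReal} (h : y ≤ z) :
    M.returnBelow π s y ≤ M.returnBelow π s z :=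
  measure_mono fun _ hω => lt_of_lt_of_le hω h

lemma le_vPolicy_iff (π : HDPolicy S A) (s : S) (α : ℝ) (z : EReal) :
    z ≤ M.vPolicy π s α ↔ M.returnBelow π s z ≤ ENNReal.ofReal α :=
  le_VaR_iff _ _ _ _

lemma measurable_returnBelow (π : HDPolicy S A) :
    Measurable fun p : S × EReal => M.returnBelow π p.1 p.2 := by
  let κ : Kernel (S × EReal) (ℕ → ℝ × S) :=
    (M.condLaw π 0).comap (fun p _ => (0, p.1))
      (measurable_pi_lambda _ fun _ => measurable_const.prodMk measurable_fst)
  have ht : MeasurableSet {q : (S × EReal) × (ℕ → ℝ × S) |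
      (M.totalReturn q.2 : EReal) < q.1.2} :=
    measurableSet_lt (by fun_prop) (by fun_prop)
  have : IsSFiniteKernel κ := by unfold κ; infer_instance
  have hκ : (fun p : S × EReal => M.returnBelow π p.1 p.2) = fun p => κ p (Prod.mk p ⁻¹'
      {q : (S × EReal) × (ℕ → ℝ × S) | (M.totalReturn q.2 : EReal) < q.1.2}) := by
    funext p
    rw [Kernel.comap_apply, returnBelow, law_eq_condLaw]
    rfl
  rw [hκ]
  exact Kernel.measurable_kernel_prodMk_left ht

lemma _root_.Measurable.returnBelow {Y : Type*} [MeasurableSpace Y] {g : Y → S} {y : Y → EReal}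
    (hg : Measurable g) (hy : Measurable y) (π : HDPolicy S A) :
    Measurable fun x => M.returnBelow π (g x) (y x) := by
  have h := (M.measurable_returnBelow π).comp (hg.prodMk hy)
  exact h

lemma measurable_vPolicy (π : HDPolicy S A) :
    Measurable fun p : S × ℝ => M.vPolicy π p.1 p.2 := by
  refine measurable_of_Ici fun x => ?_
  have : (fun p : S × ℝ => M.vPolicy π p.1 p.2) ⁻¹' Set.Ici x =
      {p | M.returnBelow π p.1 x ≤ ENNReal.ofReal p.2} := by
    ext p
    exact M.le_vPolicy_iff π p.1 p.2 x
  rw [this]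
  exact measurableSet_le (measurable_fst.returnBelow M measurable_const π)
    measurable_snd.ennreal_ofReal

lemma _root_.Measurable.vPolicy {Y : Type*} [MeasurableSpace Y] {g : Y → S} {α : Y → ℝ}
    (hg : Measurable g) (hα : Measurable α) (π : HDPolicy S A) :
    Measurable fun x => M.vPolicy π (g x) (α x) := by
  have h := (M.measurable_vPolicy π).comp (hg.prodMk hα)
  exact h

lemma totalReturn_shift_zero (ω : ℕ → ℝ × S) :
    M.totalReturn (shift 0 ω) = M.totalReturn ω := by
  simp [totalReturn, reward]

lemma totalReturn_shift {ω : ℕ → ℝ × S}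
    (h : Summable fun t : ℕ => M.discount ^ t * reward ω t) (t : ℕ) :
    M.totalReturn (shift t ω) =
      reward ω t + M.discount * M.totalReturn (shift (t + 1) ω) := by
  have hs : Summable fun n : ℕ => M.discount ^ n * reward (shift t ω) n := by
    have h1 := ((summable_nat_add_iff t).2 h).mul_left ((M.discount ^ t)⁻¹)
    refine h1.congr fun n => ?_
    have := (pow_pos M.discount_pos t).ne'
    simp only [reward, shift_succ_apply, pow_add]
    rw [show n + t + 1 = t + (n + 1) by omega]
    field_simp
  rw [totalReturn, hs.tsum_eq_zero_add, totalReturn, ← tsum_mul_left]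
  congr 1
  · simp [reward]
  · refine tsum_congr fun n => ?_
    simp only [reward, shift_succ_apply, pow_succ]
    rw [show t + (n + 1 + 1) = t + 1 + (n + 1) by omega]
    ring

/-- The levels of the procedure run with the value of `π`, if it takes the actions of `π`. -/
def level (π : HDPolicy S A) (α₀ : ℝ) : ℕ → (ℕ → ℝ × S) → ℝ
  | 0, _ => α₀
  | t + 1, ω => (M.returnBelow π (ω (t + 1)).2
      ((M.vPolicy π (ω t).2 (level π α₀ t ω) - ((reward ω t : ℝ) : EReal)) /
        ((M.discount : ℝ) : EReal))).toReal

/-- The return that the procedure has to reach from time `t` on. -/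
def target (π : HDPolicy S A) (α₀ : ℝ) : ℕ → (ℕ → ℝ × S) → EReal
  | 0, ω => M.vPolicy π (ω 0).2 α₀
  | t + 1, ω => (M.vPolicy π (ω t).2 (M.level π α₀ t ω) - ((reward ω t : ℝ) : EReal)) /
      ((M.discount : ℝ) : EReal)

variable (π : HDPolicy S A) (α₀ : ℝ)

lemma ofReal_level_succ (t : ℕ) (ω : ℕ → ℝ × S) :
    ENNReal.ofReal (M.level π α₀ (t + 1) ω) =
      M.returnBelow π (ω (t + 1)).2 (M.target π α₀ (t + 1) ω) :=
  ENNReal.ofReal_toReal (measure_ne_top _ _)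

/-- At positive times this is an equality by the choice of the level; at time `0` it is the Galois
connection. -/
lemma returnBelow_target_le (t : ℕ) (ω : ℕ → ℝ × S) :
    M.returnBelow π (ω t).2 (M.target π α₀ t ω) ≤ ENNReal.ofReal (M.level π α₀ t ω) := by
  cases t with
  | zero => exact (M.le_vPolicy_iff π _ _ _).1 le_rfl
  | succ t => exact (M.ofReal_level_succ π α₀ t ω).ge

lemma target_le_vPolicy (t : ℕ) (ω : ℕ → ℝ × S) :
    M.target π α₀ t ω ≤ M.vPolicy π (ω t).2 (M.level π α₀ t ω) :=
  (M.le_vPolicy_iff π _ _ _).2 (M.returnBelow_target_le π α₀ t ω)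

lemma level_mem_Icc {α₀ : ℝ} (hα₀ : α₀ ∈ Set.Icc (0 : ℝ) 1) (t : ℕ) (ω : ℕ → ℝ × S) :
    M.level π α₀ t ω ∈ Set.Icc (0 : ℝ) 1 := by
  cases t with
  | zero => exact hα₀
  | succ t =>
    refine ⟨ENNReal.toReal_nonneg, ?_⟩
    exact ENNReal.toReal_le_of_le_ofReal zero_le_one (by simpa using M.returnBelow_le_one π _ _)

lemma dependsOn_level (t : ℕ) : DependsOn (M.level π α₀ t) (Set.Iic t) := by
  induction t with
  | zero => exact fun _ _ _ => rfl
  | succ t ih =>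
    intro ω ω' h
    have h1 : M.level π α₀ t ω = M.level π α₀ t ω' := ih.mono_Iic t.le_succ h
    have h2 : ω t = ω' t := h t (Set.mem_Iic.2 t.le_succ)
    have h3 : ω (t + 1) = ω' (t + 1) := h (t + 1) (Set.mem_Iic.2 le_rfl)
    simp only [level, reward, h1, h2, h3]

lemma dependsOn_target (t : ℕ) : DependsOn (M.target π α₀ t) (Set.Iic t) := by
  intro ω ω' h
  cases t with
  | zero =>
    have h2 : ω 0 = ω' 0 := h 0 (Set.mem_Iic.2 le_rfl)
    simp only [target, h2]
  | succ t =>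
    have h1 : M.level π α₀ t ω = M.level π α₀ t ω' :=
      (M.dependsOn_level π α₀ t).mono_Iic t.le_succ h
    have h2 : ω t = ω' t := h t (Set.mem_Iic.2 t.le_succ)
    have h3 : ω (t + 1) = ω' (t + 1) := h (t + 1) (Set.mem_Iic.2 le_rfl)
    simp only [target, reward, h1, h2, h3]

lemma measurable_target_succ {t : ℕ} (h : Measurable (M.level π α₀ t)) :
    Measurable (M.target π α₀ (t + 1)) := by
  have h1 : Measurable fun ω : ℕ → ℝ × S => M.vPolicy π (ω t).2 (M.level π α₀ t ω) :=
    (measurable_snd.fun_comp (measurable_pi_apply t)).vPolicy M h π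
  have h2 : Measurable fun ω : ℕ → ℝ × S => ((-reward ω t : ℝ) : EReal) := by
    unfold reward; fun_prop
  -- Rewritten as a sum and a product, to which the measurability rules for `EReal` apply.
  have h3 : M.target π α₀ (t + 1) = fun ω =>
      (M.vPolicy π (ω t).2 (M.level π α₀ t ω) + ((-reward ω t : ℝ) : EReal)) *
        ((M.discount : ℝ) : EReal)⁻¹ := by
    funext ω
    rw [target, EReal.div_eq_inv_mul, mul_comm, EReal.coe_neg, sub_eq_add_neg]
  rw [h3]
  exact (h1.add h2).mul measurable_const

lemma measurable_level (t : ℕ) : Measurable (M.level π α₀ t) := by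
  induction t with
  | zero => exact measurable_const
  | succ t ih =>
    have h := ((measurable_snd.fun_comp (measurable_pi_apply (t + 1))).returnBelow M
      (M.measurable_target_succ π α₀ ih) π).ennreal_toReal
    exact h

lemma measurable_target (t : ℕ) : Measurable (M.target π α₀ t) := by
  cases t with
  | zero =>
    exact (measurable_snd.fun_comp (measurable_pi_apply 0)).vPolicy M measurable_const π
  | succ t => exact M.measurable_target_succ π α₀ (M.measurable_level π α₀ t)

lemma totalReturn_shift_succ_lt_target_iff {ω : ℕ → ℝ × S}
    (h : Summable fun t : ℕ => M.discount ^ t * reward ω t) (t : ℕ) :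
    (M.totalReturn (shift (t + 1) ω) : EReal) < M.target π α₀ (t + 1) ω ↔
      (M.totalReturn (shift t ω) : EReal) < M.vPolicy π (ω t).2 (M.level π α₀ t ω) := by
  rw [target, lt_sub_div_iff _ _ _ M.discount_pos, ← M.totalReturn_shift h]

/-- A pathwise statement: the policy that generated `ω` plays no role, so it can be used under the
law of any competitor of `π`. -/
lemma totalReturn_shift_lt_target {ω : ℕ → ℝ × S}
    (h : Summable fun t : ℕ => M.discount ^ t * reward ω t)
    (h0 : (M.totalReturn ω : EReal) < M.vPolicy π (ω 0).2 α₀) (t : ℕ) :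
    (M.totalReturn (shift t ω) : EReal) < M.target π α₀ t ω := by
  induction t with
  | zero => rwa [totalReturn_shift_zero]
  | succ t ih =>
    exact (M.totalReturn_shift_succ_lt_target_iff π α₀ h t).2
      (ih.trans_le (M.target_le_vPolicy π α₀ t ω))

end MDP

/-! ### Switching policies at a fixed time -/

lemma extendHistory_mem_iff {X : Type*} {t : ℕ} {E : Set (ℕ → X)}
    (hdep : DependsOn (· ∈ E) (Set.Iic t)) {n : ℕ} (hn : t ≤ n) (ω : ℕ → X) :
    extendHistory n (fun i : Finset.Iic n => ω i) ∈ E ↔ ω ∈ E :=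
  iff_of_eq (hdep fun _ hi =>
    extendHistory_apply_of_le _ (le_trans (Set.mem_Iic.1 hi) hn))

namespace HDPolicy

open Preorder MDP

variable {S A : Type*} [MeasurableSpace S] [MeasurableSpace A]

open Classical in
/-- Follow `F`, but switch to `π` at time `t` if the trajectory lies in `E`. -/
def switch (F π : HDPolicy S A) (t : ℕ) {E : Set (ℕ → ℝ × S)} (hE : MeasurableSet E) :
    HDPolicy S A where
  act n h := if t ≤ n ∧ extendHistory n h ∈ E
    then π.action (shift t (extendHistory n h)) (n - t) else F.act n h
  measurable_act n := by
    refine Measurable.ite ?_ ?_ (F.measurable_act n)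
    · exact (MeasurableSet.const _).inter (measurable_extendHistory n hE)
    · exact (measurable_action π (n - t)).comp
        ((measurable_shift t).comp (measurable_extendHistory n))

variable (F π : HDPolicy S A) {t : ℕ} {E : Set (ℕ → ℝ × S)} (hE : MeasurableSet E)

lemma switch_action_of_lt {n : ℕ} (hn : n < t) (ω : ℕ → ℝ × S) :
    (F.switch π t hE).action ω n = F.action ω n := by
  simp [action, switch, not_le.2 hn]

lemma switch_action_of_mem (hdep : DependsOn (· ∈ E) (Set.Iic t)) (n : ℕ) {ω : ℕ → ℝ × S}
    (hω : ω ∈ E) : (F.switch π t hE).action ω (t + n) = π.action (shift t ω) n := by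
  have h := (extendHistory_mem_iff hdep (Nat.le_add_right t n) ω).2 hω
  rw [action, switch]
  simp only [h, Nat.le_add_right, and_self, if_true, Nat.add_sub_cancel_left]
  refine action_congr π (shift_congr fun i hi => ?_)
  exact extendHistory_apply_of_le _ hi

lemma switch_action_of_notMem (hdep : DependsOn (· ∈ E) (Set.Iic t)) (n : ℕ) {ω : ℕ → ℝ × S}
    (hω : ω ∉ E) : (F.switch π t hE).action ω (t + n) = F.action ω (t + n) := by
  have h := (extendHistory_mem_iff hdep (Nat.le_add_right t n) ω).not.2 hω
  rw [action, switch]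
  simp only [h, and_false, if_false]
  rfl

lemma markov_action (f : S → A) (hf : Measurable f) (ω : ℕ → ℝ × S) (n : ℕ) :
    (markov f hf).action ω n = f (ω n).2 := rfl

/-- Stationarity enters here: what remains of a stationary policy after time `t` is the policy
itself. -/
lemma markov_action_shift (f : S → A) (hf : Measurable f) (ω : ℕ → ℝ × S) (t n : ℕ) :
    (markov f hf).action ω (t + n) = (markov f hf).action (shift t ω) n := by
  rw [markov_action, markov_action, shift_apply_snd]

end HDPolicy

/-! ### Switching preserves optimality -/

namespace MDP

open Preorder HDPolicy

variable {S A : Type*} [MeasurableSpace S] [MeasurableSpace A] (M : MDP S A)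

lemma measurable_law (π : HDPolicy S A) : Measurable (M.law π) :=
  (M.condLaw π 0).measurable.comp
    (measurable_pi_lambda _ fun _ => measurable_const.prodMk measurable_id)

variable [MeasurableSingletonClass S]

/-- The marginal up to time `t` inclusive is unchanged: the first altered action is taken at time
`t` and affects only coordinate `t + 1` onwards. -/
lemma law_switch_map_frestrictLe [DiscreteMeasurableSpace A] [Countable A] (F π : HDPolicy S A)
    (t : ℕ) {E : Set (ℕ → ℝ × S)} (hE : MeasurableSet E) (s : S) :
    (M.law (F.switch π t hE) s).map (frestrictLe (π := fun _ => ℝ × S) t) =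
      (M.law F s).map (frestrictLe (π := fun _ => ℝ × S) t) := by
  suffices ∀ n ≤ t, (M.law (F.switch π t hE) s).map (frestrictLe (π := fun _ => ℝ × S) n) =
      (M.law F s).map (frestrictLe (π := fun _ => ℝ × S) n) from this t le_rfl
  intro n
  induction n with
  | zero => exact fun _ => M.law_map_frestrictLe_zero _ _ s
  | succ n ih =>
    intro hn
    exact M.law_map_frestrictLe_succ _ _ s (ih (by omega))
      (Filter.Eventually.of_forall fun ω => F.switch_action_of_lt π hE (by omega) ω)

variable (f : S → A) (hf : Measurable f)

/-- The Markov property for events that compare the remaining return with a threshold. -/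
lemma law_totalReturn_shift_lt (ρ : HDPolicy S A) (σ : (ℕ → ℝ × S) → HDPolicy S A)
    (t : ℕ) (s : S)
    (hact : ∀ ω₀ ω n, (∀ i ≤ t, ω i = ω₀ i) →
      ρ.action ω (t + n) = (σ ω₀).action (shift t ω) n)
    {y : (ℕ → ℝ × S) → EReal} (hy : Measurable y) (hdep : DependsOn y (Set.Iic t)) :
    M.law ρ s {ω | (M.totalReturn (shift t ω) : EReal) < y ω} =
      ∫⁻ ω, M.returnBelow (σ ω) (ω t).2 (y ω) ∂M.law ρ s := by
  have hB : MeasurableSet {p : (ℕ → ℝ × S) × (ℕ → ℝ × S) |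
      (M.totalReturn p.2 : EReal) < y p.1} :=
    measurableSet_lt (M.measurable_totalReturn.comp measurable_snd).coe_real_ereal
      (hy.comp measurable_fst)
  exact M.law_markov_property ρ σ t s hact hB
    fun ω' => hdep.map fun z => (M.totalReturn ω' : EReal) < z

variable {M} in
/-- The expected level does not increase along the procedure. -/
lemma lintegral_level_le (hM : M.ReturnWellDefined) (s₀ : S) (α₀ : ℝ) (t : ℕ) :
    ∫⁻ ω, ENNReal.ofReal (M.level (markov f hf) α₀ t ω) ∂M.law (markov f hf) s₀ ≤
      ENNReal.ofReal α₀ := by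
  induction t with
  | zero => simp [level]
  | succ t ih =>
    have hmark (t : ℕ) {y : (ℕ → ℝ × S) → EReal} (hy : Measurable y)
        (hdep : DependsOn y (Set.Iic t)) :=
      M.law_totalReturn_shift_lt (markov f hf) (fun _ => markov f hf) t s₀
        (fun _ ω n _ => markov_action_shift f hf ω t n) hy hdep
    have hv : Measurable fun ω : ℕ → ℝ × S =>
        M.vPolicy (markov f hf) (ω t).2 (M.level (markov f hf) α₀ t ω) :=
      (measurable_snd.comp (measurable_pi_apply t)).vPolicy M
        (M.measurable_level (markov f hf) α₀ t) (markov f hf)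
    have hvdep : DependsOn (fun ω : ℕ → ℝ × S =>
        M.vPolicy (markov f hf) (ω t).2 (M.level (markov f hf) α₀ t ω)) (Set.Iic t) :=
      (dependsOn_eval le_rfl).map₂ (M.dependsOn_level (markov f hf) α₀ t)
        fun x α => M.vPolicy (markov f hf) x.2 α
    -- The next level is the conditional probability of missing the next target, which is the same
    -- event as `G_t < v(s_t, α_t)`; given the history, this has probability at most `α_t`.
    calc ∫⁻ ω, ENNReal.ofReal (M.level (markov f hf) α₀ (t + 1) ω) ∂M.law (markov f hf) s₀
        = M.law (markov f hf) s₀ {ω | (M.totalReturn (shift (t + 1) ω) : EReal) <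
            M.target (markov f hf) α₀ (t + 1) ω} := by
          rw [hmark (t + 1) (M.measurable_target _ α₀ _) (M.dependsOn_target _ α₀ _)]
          exact lintegral_congr fun ω => M.ofReal_level_succ _ α₀ t ω
      _ = M.law (markov f hf) s₀ {ω | (M.totalReturn (shift t ω) : EReal) <
            M.vPolicy (markov f hf) (ω t).2 (M.level (markov f hf) α₀ t ω)} := by
          refine measure_congr ?_
          filter_upwards [hM (markov f hf) s₀] with ω hω
          exact propext (M.totalReturn_shift_succ_lt_target_iff _ α₀ hω t)
      _ = ∫⁻ ω, M.returnBelow (markov f hf) (ω t).2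
            (M.vPolicy (markov f hf) (ω t).2 (M.level (markov f hf) α₀ t ω))
            ∂M.law (markov f hf) s₀ := hmark t hv hvdep
      _ ≤ ∫⁻ ω, ENNReal.ofReal (M.level (markov f hf) α₀ t ω) ∂M.law (markov f hf) s₀ :=
          lintegral_mono fun ω => (M.le_vPolicy_iff _ _ _ _).1 le_rfl
      _ ≤ ENNReal.ofReal α₀ := ih

variable {M f hf} {s₀ : S} {α₀ : ℝ} [DiscreteMeasurableSpace A] [Countable A]

/-- Switching to a policy that reaches the current target at the current level keeps optimality. -/
lemma IsVaROptimal.switch (hM : M.ReturnWellDefined)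
    (hopt : M.IsVaROptimal s₀ α₀ (markov f hf)) (π : HDPolicy S A) (t : ℕ)
    {E : Set (ℕ → ℝ × S)} (hE : MeasurableSet E) (hdep : DependsOn (· ∈ E) (Set.Iic t))
    (hπ : ∀ ω ∈ E, M.returnBelow π (ω t).2 (M.target (markov f hf) α₀ t ω) ≤
      ENNReal.ofReal (M.level (markov f hf) α₀ t ω)) :
    M.IsVaROptimal s₀ α₀ ((markov f hf).switch π t hE) := by
  classical
  intro π'
  refine (hopt π').trans ((M.le_vPolicy_iff _ _ _ _).2 ?_)
  set F := markov f hf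
  set ρ := F.switch π t hE
  let σ : (ℕ → ℝ × S) → HDPolicy S A := fun ω => if ω ∈ E then π else F
  have hact : ∀ ω₀ ω n, (∀ i ≤ t, ω i = ω₀ i) →
      ρ.action ω (t + n) = (σ ω₀).action (shift t ω) n := by
    intro ω₀ ω n h
    have hiff : ω ∈ E ↔ ω₀ ∈ E := iff_of_eq (hdep fun i hi => h i hi)
    by_cases hω : ω ∈ E
    · simp only [σ, hiff.1 hω, if_true]
      exact F.switch_action_of_mem π hE hdep n hω
    · simp only [σ, mt hiff.2 hω, if_false]
      rw [F.switch_action_of_notMem π hE hdep n hω, markov_action_shift]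
  calc M.returnBelow ρ s₀ (M.vPolicy F s₀ α₀)
      ≤ M.law ρ s₀ {ω | (M.totalReturn (shift t ω) : EReal) < M.target F α₀ t ω} := by
        refine measure_mono_ae ?_
        filter_upwards [hM ρ s₀, M.law_ae_zero ρ s₀] with ω hω h0 hlt
        refine M.totalReturn_shift_lt_target F α₀ hω ?_ t
        rw [h0]
        exact hlt
    _ = ∫⁻ ω, M.returnBelow (σ ω) (ω t).2 (M.target F α₀ t ω) ∂M.law ρ s₀ :=
        M.law_totalReturn_shift_lt ρ σ t s₀ hact (M.measurable_target F α₀ t)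
          (M.dependsOn_target F α₀ t)
    _ ≤ ∫⁻ ω, ENNReal.ofReal (M.level F α₀ t ω) ∂M.law ρ s₀ := by
        refine lintegral_mono fun ω => ?_
        by_cases hω : ω ∈ E
        · simp only [σ, hω, if_true]
          exact hπ ω hω
        · simp only [σ, hω, if_false]
          exact M.returnBelow_target_le F α₀ t ω
    -- The level at time `t` depends only on the history up to `t`, whose law the switch does not
    -- change.
    _ = ∫⁻ ω, ENNReal.ofReal (M.level F α₀ t ω) ∂M.law F s₀ :=
        M.lintegral_law_eq_of_map_frestrictLe_eq (M.law_switch_map_frestrictLe F π t hE s₀)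
          (M.measurable_level F α₀ t).ennreal_ofReal ((M.dependsOn_level F α₀ t).map _)
    _ ≤ ENNReal.ofReal α₀ := lintegral_level_le f hf hM s₀ α₀ t

/-- If `f` is the only optimal policy, then a policy that reaches the current target at the current
level must coincide with `f` from then on. -/
lemma ae_action_eq_of_returnBelow_target_le (hM : M.ReturnWellDefined)
    (hopt : M.IsVaROptimal s₀ α₀ (markov f hf))
    (huniq : ∀ π : HDPolicy S A, M.IsVaROptimal s₀ α₀ π →
      ∀ᵐ ω ∂(M.law (markov f hf) s₀), ∀ t, π.action ω t = f (ω t).2)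
    (π : HDPolicy S A) (t : ℕ) :
    ∀ᵐ ω ∂M.law (markov f hf) s₀,
      M.returnBelow π (ω t).2 (M.target (markov f hf) α₀ t ω) ≤
        ENNReal.ofReal (M.level (markov f hf) α₀ t ω) →
      ∀ᵐ ω' ∂M.law (markov f hf) (ω t).2, ∀ n, π.action ω' n = f (ω' n).2 := by
  set E : Set (ℕ → ℝ × S) :=
    {ω | M.returnBelow π (ω t).2 (M.target (markov f hf) α₀ t ω) ≤
      ENNReal.ofReal (M.level (markov f hf) α₀ t ω)} with hEdef
  set C : Set (ℕ → ℝ × S) := {ω | ∀ n, π.action ω n = f (ω n).2} with hCdef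
  have hs : Measurable fun ω : ℕ → ℝ × S => (ω t).2 :=
    measurable_snd.comp (measurable_pi_apply t)
  have hE : MeasurableSet E :=
    measurableSet_le (hs.returnBelow M (M.measurable_target (markov f hf) α₀ t) _)
      (M.measurable_level (markov f hf) α₀ t).ennreal_ofReal
  have hdep : DependsOn (· ∈ E) (Set.Iic t) := by
    intro ω ω' h
    have h1 := M.dependsOn_level (markov f hf) α₀ t h
    have h2 := M.dependsOn_target (markov f hf) α₀ t h
    have h3 : ω t = ω' t := h t (Set.mem_Iic.2 le_rfl)
    simp only [hEdef, Set.mem_ofPred_eq, h1, h2, h3]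
  have hρ := huniq _ (hopt.switch hM π t hE hdep fun ω hω => hω)
  have hC : MeasurableSet C := by
    rw [hCdef, Set.ofPred_forall]
    exact MeasurableSet.iInter fun n => measurableSet_eq_fun (measurable_action π n)
      (hf.comp (measurable_snd.comp (measurable_pi_apply n)))
  -- By uniqueness the switched policy acts as `f`, so entering `E` and deviating afterwards has
  -- probability zero. Conditioning on the history turns this into a vanishing integral, hence an
  -- integrand that vanishes almost everywhere.
  have hmark := M.law_markov_property (markov f hf) (fun _ => markov f hf) t s₀
    (fun _ ω n _ => markov_action_shift f hf ω t n) (hE.prod hC.compl)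
    (fun ω' => hdep.map fun p => p ∧ ω' ∈ Cᶜ)
  have hzero : M.law (markov f hf) s₀ {ω | (ω, shift t ω) ∈ E ×ˢ Cᶜ} = 0 := by
    rw [← nonpos_iff_eq_zero]
    refine (measure_mono_ae ?_).trans_eq (measure_empty (μ := M.law (markov f hf) s₀))
    filter_upwards [hρ] with ω hω hmem
    refine hmem.2 fun n => ?_
    rw [← switch_action_of_mem (markov f hf) π hE hdep n hmem.1, hω, shift_apply_snd]
  rw [hzero, eq_comm] at hmark
  have hmeas : Measurable fun ω : ℕ → ℝ × S => M.law (markov f hf) (ω t).2 Cᶜ :=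
    (Measure.measurable_coe hC.compl).comp ((M.measurable_law (markov f hf)).comp hs)
  have hind : ∀ ω : ℕ → ℝ × S, M.law (markov f hf) (ω t).2 {ω' | (ω, ω') ∈ E ×ˢ Cᶜ} =
      E.indicator (fun ω : ℕ → ℝ × S => M.law (markov f hf) (ω t).2 Cᶜ) ω := by
    intro ω
    by_cases hω : ω ∈ E
    · simp only [Set.mem_prod, hω, true_and, Set.indicator_of_mem]
      rfl
    · simp [hω]
  rw [lintegral_congr hind, lintegral_eq_zero_iff (hmeas.indicator hE)] at hmark
  filter_upwards [hmark] with ω hω hmem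
  rw [Set.indicator_of_mem (show ω ∈ E from hmem)] at hω
  exact hω

end MDP

/-! ### Strict maximizers and runs with the value of `f` -/

namespace MDP

open Preorder HDPolicy

variable {S A : Type*} [MeasurableSpace S] [MeasurableSpace A] (M : MDP S A)
  (f : S → A) (hf : Measurable f) (α₀ : ℝ)

lemma le_qPolicy_iff (π : HDPolicy S A) (s : S) (α : ℝ) (b : A) (z : EReal) :
    z ≤ M.qPolicy π s α b ↔ M.returnBelow (π.withFirst b) s z ≤ ENNReal.ofReal α :=
  M.le_vPolicy_iff _ _ _ _

lemma le_iSup_qPolicy_iff [Finite A] [Nonempty A] (π : HDPolicy S A) (s : S) (α : ℝ) (z : EReal) :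
    z ≤ ⨆ b, M.qPolicy π s α b ↔
      ∃ b, M.returnBelow (π.withFirst b) s z ≤ ENNReal.ofReal α := by
  simp_rw [← le_qPolicy_iff]
  constructor
  · intro h
    obtain ⟨b, hb⟩ := exists_eq_ciSup_of_finite (f := fun b => M.qPolicy π s α b)
    exact ⟨b, hb ▸ h⟩
  · rintro ⟨b, hb⟩
    exact hb.trans (le_iSup (fun b => M.qPolicy π s α b) b)

/-- At time `t`, every first action other than that of `f` misses the target at the current level. -/
def IsStrictAt (t : ℕ) (ω : ℕ → ℝ × S) : Prop :=
  ∀ b, b ≠ f (ω t).2 → ENNReal.ofReal (M.level (markov f hf) α₀ t ω) <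
    M.returnBelow ((markov f hf).withFirst b) (ω t).2 (M.target (markov f hf) α₀ t ω)

lemma dependsOn_isStrictAt (t : ℕ) : DependsOn (M.IsStrictAt f hf α₀ t) (Set.Iic t) := by
  intro ω ω' h
  have h1 := M.dependsOn_level (markov f hf) α₀ t h
  have h2 := M.dependsOn_target (markov f hf) α₀ t h
  have h3 : ω t = ω' t := h t (Set.mem_Iic.2 le_rfl)
  simp only [IsStrictAt, h1, h2, h3]

variable [DiscreteMeasurableSpace A] [Finite A]

lemma measurableSet_isStrictAt (t : ℕ) : MeasurableSet {ω | M.IsStrictAt f hf α₀ t ω} := by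
  have : {ω | M.IsStrictAt f hf α₀ t ω} = ⋂ b, ({ω | f (ω t).2 = b} ∪
      {ω | ENNReal.ofReal (M.level (markov f hf) α₀ t ω) <
        M.returnBelow ((markov f hf).withFirst b) (ω t).2 (M.target (markov f hf) α₀ t ω)}) := by
    ext ω
    simp only [IsStrictAt, Set.mem_iInter, Set.mem_union, Set.mem_ofPred_eq]
    exact forall_congr' fun b => by rw [or_iff_not_imp_left, ne_comm]
  rw [this]
  have hs : Measurable fun ω : ℕ → ℝ × S => (ω t).2 :=
    measurable_snd.comp (measurable_pi_apply t)
  refine MeasurableSet.iInter fun b => MeasurableSet.union ?_ ?_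
  · exact (hf.comp hs) (measurableSet_singleton b)
  · exact measurableSet_lt (M.measurable_level (markov f hf) α₀ t).ennreal_ofReal
      (hs.returnBelow M (M.measurable_target (markov f hf) α₀ t) _)

variable [MeasurableSingletonClass S]

lemma law_withFirst_markov (s : S) :
    M.law ((markov f hf).withFirst (f s)) s = M.law (markov f hf) s := by
  refine M.law_congr _ _ s ?_
  filter_upwards [M.law_ae_zero ((markov f hf).withFirst (f s)) s] with ω hω n
  cases n with
  | zero => rw [markov_action, hω]; rfl
  | succ n => rfl

lemma returnBelow_withFirst_markov (s : S) (y : EReal) :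
    M.returnBelow ((markov f hf).withFirst (f s)) s y = M.returnBelow (markov f hf) s y := by
  rw [returnBelow, law_withFirst_markov, returnBelow]

lemma qPolicy_markov_self (s : S) (α : ℝ) :
    M.qPolicy (markov f hf) s α (f s) = M.vPolicy (markov f hf) s α := by
  rw [qPolicy, vPolicy, law_withFirst_markov, vPolicy]

variable {M f hf α₀}

lemma IsStrictAt.qPolicy_lt {t : ℕ} {ω : ℕ → ℝ × S} (h : M.IsStrictAt f hf α₀ t ω) {b : A}
    (hb : b ≠ f (ω t).2) :
    M.qPolicy (markov f hf) (ω t).2 (M.level (markov f hf) α₀ t ω) b <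
      M.qPolicy (markov f hf) (ω t).2 (M.level (markov f hf) α₀ t ω) (f (ω t).2) := by
  rw [qPolicy_markov_self]
  refine lt_of_lt_of_le ?_ (M.target_le_vPolicy (markov f hf) α₀ t ω)
  rw [← not_le, le_qPolicy_iff, not_le]
  exact h b hb

/-- A level feasible through `f` is at least the probability defining `level`; one feasible through
another action exceeds it by strictness. -/
lemma IsStrictAt.isLeast_level (hα₀ : α₀ ∈ Set.Icc (0 : ℝ) 1) {t : ℕ} {ω : ℕ → ℝ × S}
    (h : M.IsStrictAt f hf α₀ (t + 1) ω) :
    IsLeast {β : ℝ | β ∈ Set.Icc (0 : ℝ) 1 ∧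
      (M.qPolicy (markov f hf) (ω t).2 (M.level (markov f hf) α₀ t ω) (f (ω t).2) -
        ((reward ω t : ℝ) : EReal)) / ((M.discount : ℝ) : EReal) ≤
          ⨆ b, M.qPolicy (markov f hf) (ω (t + 1)).2 β b}
      (M.level (markov f hf) α₀ (t + 1) ω) := by
  have : Nonempty A := ⟨f (ω t).2⟩
  rw [qPolicy_markov_self]
  simp only [le_iSup_qPolicy_iff]
  constructor
  · refine ⟨M.level_mem_Icc _ hα₀ _ _, f (ω (t + 1)).2, ?_⟩
    rw [returnBelow_withFirst_markov]
    exact M.returnBelow_target_le (markov f hf) α₀ (t + 1) ω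
  · rintro β ⟨hβ, b, hb⟩
    refine (ENNReal.ofReal_le_ofReal_iff hβ.1).1 ?_
    by_cases hbf : b = f (ω (t + 1)).2
    · rw [hbf, returnBelow_withFirst_markov] at hb
      exact (M.ofReal_level_succ (markov f hf) α₀ t ω).trans_le hb
    · exact (h b hbf).le.trans hb

lemma isRun_level (hα₀ : α₀ ∈ Set.Icc (0 : ℝ) 1) {s₀ : S} {ω : ℕ → ℝ × S}
    (h0 : (ω 0).2 = s₀) (h : ∀ t, M.IsStrictAt f hf α₀ t ω) :
    M.IsRun (M.qPolicy (markov f hf)) s₀ α₀ ω (fun t => f (ω t).2)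
      (fun t => M.level (markov f hf) α₀ t ω) where
  state_zero := h0
  level_zero := rfl
  argmax t b := by
    by_cases hb : b = f (ω t).2
    · rw [hb]
    · exact ((h t).qPolicy_lt hb).le
  level_succ t := (h (t + 1)).isLeast_level hα₀

lemma IsRun.eq_level (hα₀ : α₀ ∈ Set.Icc (0 : ℝ) 1) {s₀ : S} {ω : ℕ → ℝ × S} {a : ℕ → A}
    {α : ℕ → ℝ} (hrun : M.IsRun (M.qPolicy (markov f hf)) s₀ α₀ ω a α) {t : ℕ}
    (h : ∀ k ≤ t, M.IsStrictAt f hf α₀ k ω) :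
    α t = M.level (markov f hf) α₀ t ω ∧ a t = f (ω t).2 := by
  have hact : ∀ k ≤ t, α k = M.level (markov f hf) α₀ k ω → a k = f (ω k).2 := by
    intro k hk hα
    by_contra hne
    have h1 := (h k hk).qPolicy_lt hne
    have h2 := hrun.argmax k (f (ω k).2)
    rw [hα] at h2
    exact absurd h2 (not_le.2 h1)
  suffices ∀ k ≤ t, α k = M.level (markov f hf) α₀ k ω from
    ⟨this t le_rfl, hact t le_rfl (this t le_rfl)⟩
  intro k
  induction k with
  | zero => exact fun _ => hrun.level_zero
  | succ k ih =>
    intro hk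
    have hα := ih (by omega)
    have hl := hrun.level_succ k
    rw [hα, hact k (by omega) hα] at hl
    exact hl.unique ((h (k + 1) hk).isLeast_level hα₀)

/-- The initial history is almost surely `(0, s)`, so the first action is deterministic. -/
lemma vPolicy_eq_qPolicy (π : HDPolicy S A) (s : S) (α : ℝ) :
    M.vPolicy π s α = M.qPolicy π s α (π.act 0 fun _ => (0, s)) := by
  have : M.law π s = M.law (π.withFirst (π.act 0 fun _ => (0, s))) s := by
    refine M.law_congr _ _ s ?_
    filter_upwards [M.law_ae_zero π s] with ω hω n
    cases n with
    | zero =>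
      change π.act 0 _ = π.act 0 _
      congr 1
      funext ⟨i, hi⟩
      have : i = 0 := by simpa using hi
      subst this
      exact hω
    | succ n => rfl
  rw [qPolicy, vPolicy, this, vPolicy]

lemma iSup_qStar (s : S) (α : ℝ) : ⨆ b, M.qStar s α b = M.vStar s α := by
  refine le_antisymm (iSup_le fun b => iSup_le fun π => ?_) (iSup_le fun π => ?_)
  · exact le_iSup (fun π => M.vPolicy π s α) (π.withFirst b)
  · rw [vPolicy_eq_qPolicy]
    exact (le_iSup (fun π => M.qPolicy π s α _) π).trans (le_iSup (fun b => M.qStar s α b) _)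

variable {s₀ : S}

lemma ae_isStrictAt (hM : M.ReturnWellDefined) (hopt : M.IsVaROptimal s₀ α₀ (markov f hf))
    (huniq : ∀ π : HDPolicy S A, M.IsVaROptimal s₀ α₀ π →
      ∀ᵐ ω ∂(M.law (markov f hf) s₀), ∀ t, π.action ω t = f (ω t).2) :
    ∀ᵐ ω ∂M.law (markov f hf) s₀, ∀ t, M.IsStrictAt f hf α₀ t ω := by
  refine ae_all_iff.2 fun t => ae_all_iff.2 fun b => ?_
  filter_upwards [ae_action_eq_of_returnBelow_target_le hM hopt huniq
    ((markov f hf).withFirst b) t] with ω hω hb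
  by_contra hlt
  -- If `b` reached the target, the policy starting with `b` would act as `f` almost surely from
  -- `s_t`; one trajectory starting there already gives `b = f(s_t)`.
  obtain ⟨ω', h', h0⟩ := ((hω (not_lt.1 hlt)).and
    (M.law_ae_zero (markov f hf) (ω t).2)).exists
  refine hb ?_
  have := h' 0
  rw [h0] at this
  exact this

/-- A policy that reaches the current target at the current level has the law of `f`. -/
lemma ae_law_eq_of_returnBelow_target_le (hM : M.ReturnWellDefined)
    (hopt : M.IsVaROptimal s₀ α₀ (markov f hf))
    (huniq : ∀ π : HDPolicy S A, M.IsVaROptimal s₀ α₀ π →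
      ∀ᵐ ω ∂(M.law (markov f hf) s₀), ∀ t, π.action ω t = f (ω t).2)
    (π : HDPolicy S A) :
    ∀ᵐ ω ∂M.law (markov f hf) s₀, ∀ t,
      M.returnBelow π (ω t).2 (M.target (markov f hf) α₀ t ω) ≤
        ENNReal.ofReal (M.level (markov f hf) α₀ t ω) →
      M.law π (ω t).2 = M.law (markov f hf) (ω t).2 := by
  refine ae_all_iff.2 fun t => ?_
  filter_upwards [ae_action_eq_of_returnBelow_target_le hM hopt huniq π t] with ω hω hle
  refine (M.law_congr _ _ _ ?_).symm
  filter_upwards [hω hle] with ω' h' n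
  exact (h' n).symm

end MDP

/-! ### Countable families of policies and optimality of the visited values -/

lemma exists_countable_coinitial {ι : Type*} (r : ι → ENNReal) :
    ∃ C : Set ι, C.Countable ∧ ∀ i, ∃ j ∈ C, r j ≤ r i := by
  rcases isEmpty_or_nonempty ι with h | h
  · exact ⟨∅, Set.countable_empty, fun i => h.elim i⟩
  obtain ⟨u, -, hu, hmem⟩ :=
    exists_seq_tendsto_sInf (Set.range_nonempty r) (OrderBot.bddBelow (Set.range r))
  choose j hj using hmem
  -- A minimizer suffices if there is one; otherwise every value lies strictly above the infimum and
  -- a minimizing sequence gets below it.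
  by_cases hmin : ∃ i, r i = sInf (Set.range r)
  · obtain ⟨i, hi⟩ := hmin
    exact ⟨{i}, Set.countable_singleton i, fun k =>
      ⟨i, rfl, hi ▸ sInf_le (Set.mem_range_self k)⟩⟩
  · refine ⟨Set.range j, Set.countable_range j, fun k => ?_⟩
    have hlt : sInf (Set.range r) < r k :=
      lt_of_le_of_ne (sInf_le (Set.mem_range_self k)) fun h => hmin ⟨k, h.symm⟩
    obtain ⟨n, hn⟩ := (hu.eventually_lt_const hlt).exists
    exact ⟨j n, Set.mem_range_self n, (hj n).trans_le hn.le⟩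

namespace MDP

open Preorder HDPolicy

variable {S A : Type*} [MeasurableSpace S] [MeasurableSpace A] (M : MDP S A)

lemma exists_countable_policies [Countable S] :
    ∃ C : Set (HDPolicy S A), C.Countable ∧ ∀ (s : S) (x : ℚ) (π : HDPolicy S A),
      ∃ π' ∈ C, M.returnBelow π' s (x : ℝ) ≤ M.returnBelow π s (x : ℝ) := by
  choose C hC hle using fun (s : S) (x : ℚ) =>
    exists_countable_coinitial fun π : HDPolicy S A => M.returnBelow π s (x : ℝ)
  refine ⟨⋃ (s) (x), C s x, Set.countable_iUnion fun s => Set.countable_iUnion fun x => hC s x,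
    fun s x π => ?_⟩
  obtain ⟨π', h', hπ'⟩ := hle s x π
  exact ⟨π', Set.mem_iUnion₂.2 ⟨s, x, h'⟩, hπ'⟩

lemma vStar_mono (s : S) {α β : ℝ} (h : α ≤ β) : M.vStar s α ≤ M.vStar s β :=
  iSup_mono fun π => (M.le_vPolicy_iff π s β _).2
    (((M.le_vPolicy_iff π s α _).1 le_rfl).trans (ENNReal.ofReal_le_ofReal h))

variable [MeasurableSingletonClass S] [DiscreteMeasurableSpace A] [Finite A]

variable {M} {f : S → A} {hf : Measurable f} {s₀ : S} {α₀ : ℝ}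

/-- A policy that selects its actions by the procedure executes `f`. -/
lemma law_eq_of_isRun (hα₀ : α₀ ∈ Set.Icc (0 : ℝ) 1)
    (hstrict : ∀ᵐ ω ∂M.law (markov f hf) s₀, ∀ t, M.IsStrictAt f hf α₀ t ω)
    (π : HDPolicy S A)
    (hrun : ∀ᵐ ω ∂(M.law π s₀), ∃ α : ℕ → ℝ,
      M.IsRun (M.qPolicy (markov f hf)) s₀ α₀ ω (π.action ω) α) :
    (∀ᵐ ω ∂(M.law π s₀), ∀ t, π.action ω t = f (ω t).2) ∧
      M.law π s₀ = M.law (markov f hf) s₀ := by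
  -- Strictness is known only under the law of `f`. It transfers to `π` up to time `n` once the
  -- marginals up to `n` agree; this forces the action at time `n`, which gives the marginals up to
  -- `n + 1`.
  have hact (n : ℕ) (h : (M.law π s₀).map (frestrictLe (π := fun _ => ℝ × S) n) =
      (M.law (markov f hf) s₀).map (frestrictLe (π := fun _ => ℝ × S) n)) :
      ∀ᵐ ω ∂M.law π s₀, π.action ω n = f (ω n).2 := by
    have hms : MeasurableSet {ω | ∀ k ≤ n, M.IsStrictAt f hf α₀ k ω} := by
      simp only [Set.ofPred_forall]
      exact MeasurableSet.iInter fun k => MeasurableSet.iInter fun _ =>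
        M.measurableSet_isStrictAt f hf α₀ k
    have hdep : DependsOn (fun ω => ∀ k ≤ n, M.IsStrictAt f hf α₀ k ω) (Set.Iic n) :=
      fun ω ω' hω => propext (forall₂_congr fun k hk =>
        iff_of_eq ((M.dependsOn_isStrictAt f hf α₀ k).mono_Iic hk hω))
    have hs := (M.ae_law_iff_of_map_frestrictLe_eq h hms hdep).2
      (hstrict.mono fun ω hω k _ => hω k)
    filter_upwards [hs, hrun] with ω hω ⟨α, hα⟩
    exact (hα.eq_level hα₀ hω).2
  have hmarg (n : ℕ) : (M.law π s₀).map (frestrictLe (π := fun _ => ℝ × S) n) =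
      (M.law (markov f hf) s₀).map (frestrictLe (π := fun _ => ℝ × S) n) := by
    induction n with
    | zero => exact M.law_map_frestrictLe_zero _ _ s₀
    | succ n ih => exact M.law_map_frestrictLe_succ _ _ s₀ ih (hact n ih)
  exact ⟨ae_all_iff.2 fun n => hact n (hmarg n), Measure.ext_of_map_frestrictLe hmarg⟩

/-- If `f` is the only optimal policy, its values at the visited states and levels are optimal. -/
lemma ae_vPolicy_eq_vStar [Countable S] (hM : M.ReturnWellDefined)
    (hopt : M.IsVaROptimal s₀ α₀ (markov f hf))
    (huniq : ∀ π : HDPolicy S A, M.IsVaROptimal s₀ α₀ π →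
      ∀ᵐ ω ∂(M.law (markov f hf) s₀), ∀ t, π.action ω t = f (ω t).2) :
    ∀ᵐ ω ∂M.law (markov f hf) s₀, ∀ t,
      M.vPolicy (markov f hf) (ω t).2 (M.level (markov f hf) α₀ t ω) =
        M.vStar (ω t).2 (M.level (markov f hf) α₀ t ω) := by
  obtain ⟨C, hC, hCle⟩ := M.exists_countable_policies
  have hall := (ae_ball_iff hC).2 fun π _ =>
    ae_law_eq_of_returnBelow_target_le hM hopt huniq π
  filter_upwards [hall] with ω hω t
  refine le_antisymm (le_iSup (fun π => M.vPolicy π _ _) _) (iSup_le fun π => ?_)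
  by_contra! hlt
  obtain ⟨x, hx1, hx2⟩ := EReal.lt_iff_exists_rat_btwn.1 hlt
  -- `π'` reaches `x`, hence also the smaller target, at the current level. It therefore has the law
  -- of `f`, so `f` would reach `x` too, above its own value.
  obtain ⟨π', hπ'C, hπ'⟩ := hCle (ω t).2 x π
  have hx := hπ'.trans ((M.le_vPolicy_iff _ _ _ _).1 hx2.le)
  have hlaw := hω π' hπ'C t ((M.returnBelow_mono π' _
    ((M.target_le_vPolicy (markov f hf) α₀ t ω).trans hx1.le)).trans hx)
  rw [returnBelow, hlaw] at hx
  exact absurd ((M.le_vPolicy_iff (markov f hf) _ _ _).2 hx) (not_le.2 hx1)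

/-- If `f` is the only optimal policy and optimal values are attained, no smaller level than that
of the procedure lets the optimal value reach the target. -/
lemma ae_level_le_of_target_le_vStar [Countable S] (hM : M.ReturnWellDefined)
    (hopt : M.IsVaROptimal s₀ α₀ (markov f hf))
    (huniq : ∀ π : HDPolicy S A, M.IsVaROptimal s₀ α₀ π →
      ∀ᵐ ω ∂(M.law (markov f hf) s₀), ∀ t, π.action ω t = f (ω t).2)
    (hα₀ : α₀ ∈ Set.Icc (0 : ℝ) 1) (hatt : M.VStarAttained) :
    ∀ᵐ ω ∂M.law (markov f hf) s₀, ∀ (t : ℕ) (β : ℝ), 0 ≤ β →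
      M.target (markov f hf) α₀ (t + 1) ω ≤ M.vStar (ω (t + 1)).2 β →
      M.level (markov f hf) α₀ (t + 1) ω ≤ β := by
  -- Attainment supplies one optimal policy per state and rational level, a countable family.
  choose g hg using hatt
  have hall : ∀ᵐ ω ∂M.law (markov f hf) s₀, ∀ (s : S) (x : ℚ) (hx : (x : ℝ) ∈ Set.Icc (0 : ℝ) 1),
      ∀ t, M.returnBelow (g s x hx) (ω t).2 (M.target (markov f hf) α₀ t ω) ≤
        ENNReal.ofReal (M.level (markov f hf) α₀ t ω) →
      M.law (g s x hx) (ω t).2 = M.law (markov f hf) (ω t).2 :=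
    ae_all_iff.2 fun s => ae_all_iff.2 fun x => ae_all_iff.2 fun hx =>
      ae_law_eq_of_returnBelow_target_le hM hopt huniq _
  filter_upwards [hall] with ω hω t β hβ hle
  by_contra! hlt
  obtain ⟨x, hx1, hx2⟩ := exists_rat_btwn hlt
  have hx : (x : ℝ) ∈ Set.Icc (0 : ℝ) 1 :=
    ⟨hβ.trans hx1.le, hx2.le.trans (M.level_mem_Icc (markov f hf) hα₀ (t + 1) ω).2⟩
  have hb := hle.trans (M.vStar_mono (ω (t + 1)).2 hx1.le)
  rw [← hg _ x hx, le_vPolicy_iff] at hb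
  have hlevel_lt : ENNReal.ofReal x < ENNReal.ofReal (M.level (markov f hf) α₀ (t + 1) ω) :=
    (ENNReal.ofReal_lt_ofReal_iff_of_nonneg hx.1).2 hx2
  -- The policy optimal at level `x` has the law of `f`, so `f` misses the target with probability
  -- at most `x`, whereas this probability is the level itself.
  have hlaw := hω _ x hx (t + 1) (hb.trans hlevel_lt.le)
  rw [returnBelow, hlaw] at hb
  rw [ofReal_level_succ] at hlevel_lt
  exact absurd hb (not_le.2 hlevel_lt)

/-- The canonical run with the value of `f` is a run with the optimal value. -/
lemma isRun_qStar_level {ω : ℕ → ℝ × S}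
    (hrun : M.IsRun (M.qPolicy (markov f hf)) s₀ α₀ ω (fun t => f (ω t).2)
      (fun t => M.level (markov f hf) α₀ t ω))
    (hval : ∀ t, M.vPolicy (markov f hf) (ω t).2 (M.level (markov f hf) α₀ t ω) =
      M.vStar (ω t).2 (M.level (markov f hf) α₀ t ω))
    (hlevel : ∀ (t : ℕ) (β : ℝ), 0 ≤ β →
      M.target (markov f hf) α₀ (t + 1) ω ≤ M.vStar (ω (t + 1)).2 β →
      M.level (markov f hf) α₀ (t + 1) ω ≤ β) :
    M.IsRun M.qStar s₀ α₀ ω (fun t => f (ω t).2)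
      (fun t => M.level (markov f hf) α₀ t ω) := by
  have hle (s : S) (α : ℝ) (b : A) : M.qStar s α b ≤ M.vStar s α :=
    iSup_qStar (M := M) s α ▸ le_iSup (fun b => M.qStar s α b) b
  have hq (t : ℕ) : M.qStar (ω t).2 (M.level (markov f hf) α₀ t ω) (f (ω t).2) =
      M.vPolicy (markov f hf) (ω t).2 (M.level (markov f hf) α₀ t ω) := by
    refine le_antisymm ((hle _ _ _).trans (hval t).ge) ?_
    rw [← qPolicy_markov_self]
    exact le_iSup (fun π => M.qPolicy π _ _ _) (markov f hf)
  refine ⟨hrun.state_zero, hrun.level_zero, fun t b => ?_, fun t => ?_⟩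
  · rw [hq, hval]
    exact hle _ _ _
  · simp only [hq, iSup_qStar]
    refine ⟨⟨(hrun.level_succ t).1.1, ?_⟩, fun β hβ => hlevel t β hβ.1.1 hβ.2⟩
    exact (M.target_le_vPolicy (markov f hf) α₀ (t + 1) ω).trans (hval (t + 1)).le

end MDP

end

theorem proposition3 {S A : Type*} [MeasurableSpace S] [MeasurableSingletonClass S]
    [MeasurableSpace A] [DiscreteMeasurableSpace A] [Finite A]
    (M : MDP S A) (hM : M.ReturnWellDefined)
    (s₀ : S) (α₀ : ℝ) (hα₀ : α₀ ∈ Set.Icc (0 : ℝ) 1)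
    (f : S → A) (hf : Measurable f)
    -- the stationary Markovian policy `f` is `α₀`-VaR optimal from `s₀`
    (hopt : M.IsVaROptimal s₀ α₀ (HDPolicy.markov f hf))
    -- it is the only `α₀`-VaR optimal policy (up to histories that are almost surely not met)
    (huniq : ∀ π : HDPolicy S A, M.IsVaROptimal s₀ α₀ π →
      ∀ᵐ ω ∂(M.law (HDPolicy.markov f hf) s₀), ∀ t, π.action ω t = f (ω t).2) :
    -- any execution of the procedure with `q^f`, however ties are broken, executes `f`
    (∀ π : HDPolicy S A,
      (∀ᵐ ω ∂(M.law π s₀), ∃ α : ℕ → ℝ,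
        M.IsRun (M.qPolicy (HDPolicy.markov f hf)) s₀ α₀ ω (π.action ω) α) →
      (∀ᵐ ω ∂(M.law π s₀), ∀ t, π.action ω t = f (ω t).2) ∧
        M.law π s₀ = M.law (HDPolicy.markov f hf) s₀) ∧
    -- the procedure can indeed be run, and the maximizing action is always unique
    (∀ᵐ ω ∂(M.law (HDPolicy.markov f hf) s₀), ∃ α : ℕ → ℝ,
      M.IsRun (M.qPolicy (HDPolicy.markov f hf)) s₀ α₀ ω (fun t => f (ω t).2) α ∧
      ∀ t b, b ≠ f (ω t).2 →
        M.qPolicy (HDPolicy.markov f hf) (ω t).2 (α t) b <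
          M.qPolicy (HDPolicy.markov f hf) (ω t).2 (α t) (f (ω t).2)) ∧
    -- `q^f` is optimal at the visited pairs
    (Countable S →
      ∀ᵐ ω ∂(M.law (HDPolicy.markov f hf) s₀), ∀ (a : ℕ → A) (α : ℕ → ℝ),
        M.IsRun (M.qPolicy (HDPolicy.markov f hf)) s₀ α₀ ω a α →
        ∀ t, M.qPolicy (HDPolicy.markov f hf) (ω t).2 (α t) (f (ω t).2) =
          M.vStar (ω t).2 (α t)) ∧
    -- and these are the pairs visited when the optimal `q*` is used instead
    (Countable S → M.VStarAttained →
      ∀ᵐ ω ∂(M.law (HDPolicy.markov f hf) s₀), ∃ α : ℕ → ℝ,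
        M.IsRun (M.qPolicy (HDPolicy.markov f hf)) s₀ α₀ ω (fun t => f (ω t).2) α ∧
        M.IsRun M.qStar s₀ α₀ ω (fun t => f (ω t).2) α) := by
  have hstrict := MDP.ae_isStrictAt hM hopt huniq
  have hzero := M.law_ae_zero (HDPolicy.markov f hf) s₀
  refine ⟨fun π hrun => MDP.law_eq_of_isRun hα₀ hstrict π hrun, ?_, fun _ => ?_, fun _ hatt => ?_⟩
  · filter_upwards [hstrict, hzero] with ω hω h0
    exact ⟨_, MDP.isRun_level hα₀ (by rw [h0]) hω, fun t b hb => (hω t).qPolicy_lt hb⟩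
  · filter_upwards [hstrict, MDP.ae_vPolicy_eq_vStar hM hopt huniq] with ω hω hval a α hrun t
    rw [(hrun.eq_level hα₀ fun k _ => hω k).1, MDP.qPolicy_markov_self, hval]
  · filter_upwards [hstrict, hzero, MDP.ae_vPolicy_eq_vStar hM hopt huniq,
      MDP.ae_level_le_of_target_le_vStar hM hopt huniq hα₀ hatt] with ω hω h0 hval hlevel
    have hrun := MDP.isRun_level hα₀ (by rw [h0]) hω
    exact ⟨_, hrun, MDP.isRun_qStar_level hrun hval hlevel⟩
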